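/- Let $\mathcal H$ be a real Hilbert space, let $A\colon\mathcal H\to 2^{\mathcal H}$ be maximally monotone, and let $B\colon\mathcal H\to\mathcal H$ be monotone and $\mu$-Lipschitzian, that is, $\|Bx-By\|\le\mu\|x-y\|$ for all $x,y\in\mathcal H$, where $\mu\in\left]0,+\infty\right[$. Suppose that the set $\operatorname{zer}(A+B)=\{x\in\mathcal H : 0\in Ax+Bx\}$ is nonempty. Let $\gamma\in\left]0,+\infty\right[$, let $x_{-1},x_0\in\mathcal H$, and let $(x_n)_{n\in\mathbb N}$ be generated by the reflected forward-backward iteration $$(\forall n\in\mathbb N)\quad y_n=2x_n-x_{n-1},\qquad x_{n+1}=J_{\gamma A}(x_n-\gamma By_n),\qquad\text{where } J_{\gamma A}=(\operatorname{Id}+\gamma A)^{-1}.$$ Then the following hold. (i) Suppose that $B$ is $\beta$-cocoercive for some $\beta\in\left]0,+\infty\right[$, that is, $\langle x-y, Bx-By\rangle\ge\beta\|Bx-By\|^2$ for all $x,y\in\mathcal H$, and that $\gamma\in\left]0,\beta(1-\varepsilon)/2\right]$ for some $\varepsilon\in\left]0,1\right[$. Then $(x_n)_{n\in\mathbb N}$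 converges weakly to some point $\overline x\in\operatorname{zer}(A+B)$. (ii) Suppose that $\gamma\in\left]0,(\sqrt2-1)/\mu\right[$. Then $(x_n)_{n\in\mathbb N}$ converges weakly to some point $\overline x\in\operatorname{zer}(A+B)$. -/

import Mathlib

open Set Filter Topology
open scoped Pointwise NNReal

namespace MonotoneInclusion

variable {H : Type*} [NormedAddCommGroup H] [InnerProductSpace ℝ H]

/-- The graph of a set-valued operator `T : H → 2^H`. -/
def gra (T : H → Set H) : Set (H × H) := {p | p.2 ∈ T p.1}

/-- The inverse of a set-valued operator, `T⁻¹ u = {x | u ∈ T x}`. -/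
def opInv (T : H → Set H) : H → Set H := fun u => {x | u ∈ T x}

/-- The set of zeros `zer T = T⁻¹ 0`. -/
def zer (T : H → Set H) : Set H := opInv T 0

/-- A single-valued operator, seen as a set-valued one. -/
def toSetOp (B : H → H) : H → Set H := fun x => {B x}

/-- Monotonicity of a set-valued operator. -/
def IsMonotoneOp (T : H → Set H) : Prop :=
  ∀ x y u v : H, u ∈ T x → v ∈ T y → 0 ≤ inner ℝ (x - y) (u - v)

/-- Maximal monotonicity: no monotone operator has a graph properly containing that of `T`. -/
def IsMaximallyMonotone (T : H → Set H) : Prop :=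
  IsMonotoneOp T ∧ ¬ ∃ S : H → Set H, IsMonotoneOp S ∧ gra T ⊂ gra S

/-- The resolvent `J_T = (Id + T)⁻¹`, as a set-valued operator; the sum is the pointwise
Minkowski sum of set-valued operators. -/
def resolventOp (T : H → Set H) : H → Set H := opInv (toSetOp id + T)

/-- `B` is `β`-cocoercive. -/
def IsCocoercive (β : ℝ) (B : H → H) : Prop :=
  ∀ x y : H, β * ‖B x - B y‖ ^ 2 ≤ inner ℝ (x - y) (B x - B y)

/-- `(x n)` and `(y n)` are generated by the reflected forward-backward iteration with step `γ`
from the starting points `x 0` and `xneg` (the latter is the iterate of index `-1`). -/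
structure IsReflectedForwardBackward (A : H → Set H) (B : H → H) (γ : ℝ) (xneg : H)
    (x y : ℕ → H) : Prop where
  y_zero : y 0 = (2 : ℝ) • x 0 - xneg
  y_succ : ∀ n, y (n + 1) = (2 : ℝ) • x (n + 1) - x n
  x_succ : ∀ n, x (n + 1) ∈ resolventOp (γ • A) (x n - γ • B (y n))

/-- Weak convergence of a sequence, i.e. convergence in the weak topology of `H`. -/
def WeaklyConvergesTo (x : ℕ → H) (l : H) : Prop :=
  Tendsto (fun n => toWeakSpace ℝ H (x n)) atTop (𝓝 (toWeakSpace ℝ H l))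

end MonotoneInclusion

/-!
Fix a zero `z`. Monotonicity of `A`, tested between `z` and `x (n + 1)` and between two consecutive
iterates, shows that `‖x (n + 1) - z‖ ^ 2 + 2 * γ * ⟪B (y n) - B z, x (n + 1) - x n⟫ +
‖x (n + 1) - x n‖ ^ 2` decreases up to the error `2 * γ * ⟪B (y (n + 1)) - B (y n), x (n + 2) -
y (n + 1)⟫`. When `B` is cocoercive, the term `⟪B (y (n + 1)) - B z, y (n + 1) - z⟫` absorbs this
error; when `B` is merely Lipschitz and monotone, it is absorbed by `‖x (n + 1) - x n‖ ^ 2` and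
`‖x (n + 1) - y n‖ ^ 2`, which costs the smaller step size. Either way `x (n + 1) - x n → 0` and
`‖x n - z‖` converges. Weak cluster points are then zeros, because the sum of two maximally monotone
operators is demiclosed along sequences whose arguments asymptotically agree, and Opial's lemma
gives weak convergence.
-/

namespace MonotoneInclusion

open Bornology Metric
open scoped InnerProductSpace

theorem exists_tendsto_and_tendsto_zero_of_add_le {V D : ℕ → ℝ} (hV : ∀ n, 0 ≤ V n)
    (hD : ∀ n, 0 ≤ D n) (h : ∀ n, V (n + 1) + D n ≤ V n) :
    (∃ r, Tendsto V atTop (𝓝 r)) ∧ Tendsto D atTop (𝓝 0) := by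
  have hanti : Antitone V := antitone_nat_of_succ_le fun n => by linarith [h n, hD n]
  have hlim := tendsto_atTop_ciInf hanti ⟨0, forall_mem_range.2 hV⟩
  refine ⟨⟨_, hlim⟩, squeeze_zero hD (fun n => by linarith [h n] : ∀ n, D n ≤ V n - V (n + 1)) ?_⟩
  simpa using hlim.sub (hlim.comp (tendsto_add_atTop_nat 1))

theorem tendsto_zero_of_tendsto_norm_sq {ι E : Type*} [SeminormedAddCommGroup E] {F : Filter ι}
    {f : ι → E} (h : Tendsto (fun i => ‖f i‖ ^ 2) F (𝓝 0)) : Tendsto f F (𝓝 0) := by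
  rw [tendsto_zero_iff_norm_tendsto_zero]
  simpa using h.sqrt

theorem isBounded_range_of_tendsto_norm_sub {E : Type*} [SeminormedAddCommGroup E] {x : ℕ → E}
    {z : E} {r : ℝ} (hr : Tendsto (fun n => ‖x n - z‖) atTop (𝓝 r)) :
    IsBounded (range x) := by
  obtain ⟨C, hC⟩ := hr.bddAbove_range
  refine isBounded_closedBall (x := z) (r := C) |>.subset (range_subset_iff.2 fun n => ?_)
  rw [mem_closedBall_iff_norm]
  exact hC (mem_range_self n)

section WeakTopology

variable {𝕜 E ι : Type*} [RCLike 𝕜] [NormedAddCommGroup E] [InnerProductSpace 𝕜 E]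

theorem tendsto_inner_of_tendsto_toWeakSpace {F : Filter ι} {x : ι → E} {l : E}
    (hx : Tendsto (fun i => toWeakSpace 𝕜 E (x i)) F (𝓝 (toWeakSpace 𝕜 E l))) (w : E) :
    Tendsto (fun i => ⟪w, x i⟫_𝕜) F (𝓝 ⟪w, l⟫_𝕜) :=
  ((WeakBilin.eval_continuous (topDualPairing 𝕜 E).flip (innerSL 𝕜 w)).tendsto _).comp hx

theorem tendsto_toWeakSpace_of_tendsto {F : Filter ι} {x : ι → E} {l : E}
    (hx : Tendsto x F (𝓝 l)) :
    Tendsto (fun i => toWeakSpace 𝕜 E (x i)) F (𝓝 (toWeakSpace 𝕜 E l)) :=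
  ((toWeakSpaceCLM 𝕜 E).continuous.tendsto l).comp hx

theorem tendsto_inner_zero_of_isBounded_range {F : Filter ι} {f g : ι → E}
    (hf : IsBounded (range f)) (hg : Tendsto g F (𝓝 0)) :
    Tendsto (fun i => ⟪f i, g i⟫_𝕜) F (𝓝 0) := by
  obtain ⟨C, hC⟩ := isBounded_iff_forall_norm_le.1 hf
  refine hg.op_zero_isBoundedUnder_le (isBoundedUnder_of ⟨C, fun i => hC _ (mem_range_self i)⟩)
    (fun v w => ⟪w, v⟫_𝕜) fun v w => ?_
  rw [mul_comm]
  exact norm_inner_le_norm w v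

theorem exists_tendsto_inner_of_isBounded_range (U : Ultrafilter ι) {f g : ι → E}
    (hf : IsBounded (range f)) (hg : IsBounded (range g)) :
    ∃ σ, Tendsto (fun i => ⟪f i, g i⟫_𝕜) U (𝓝 σ) := by
  obtain ⟨C, hC⟩ := isBounded_iff_forall_norm_le.1 hf
  obtain ⟨D, hD⟩ := isBounded_iff_forall_norm_le.1 hg
  have hCD : ∀ i, ⟪f i, g i⟫_𝕜 ∈ closedBall 0 (C * D) := fun i => by
    have hfi := hC _ (mem_range_self i)
    refine mem_closedBall_zero_iff.2 ((norm_inner_le_norm _ _).trans ?_)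
    exact mul_le_mul hfi (hD _ (mem_range_self i)) (norm_nonneg _) ((norm_nonneg _).trans hfi)
  obtain ⟨σ, -, hσ⟩ := (isCompact_closedBall 0 (C * D)).ultrafilter_le_nhds
    (U.map fun i => ⟪f i, g i⟫_𝕜) (tendsto_principal.2 (.of_forall hCD))
  exact ⟨σ, hσ⟩

variable [CompleteSpace E]

theorem isCompact_toWeakSpace_image_closedBall (r : ℝ) :
    IsCompact (toWeakSpace 𝕜 E '' closedBall 0 r) := by
  let Φ : WeakDual 𝕜 E → WeakSpace 𝕜 E := fun φ =>
    toWeakSpace 𝕜 E ((InnerProductSpace.toDual 𝕜 E).symm (WeakDual.toStrongDual φ))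
  have hΦ : Continuous Φ := by
    refine WeakBilin.continuous_of_continuous_eval (topDualPairing 𝕜 E).flip fun f => ?_
    have hf : ∀ φ : WeakDual 𝕜 E, (topDualPairing 𝕜 E).flip (Φ φ) f =
        starRingEnd 𝕜 (φ ((InnerProductSpace.toDual 𝕜 E).symm f)) := fun φ => by
      change f ((InnerProductSpace.toDual 𝕜 E).symm (WeakDual.toStrongDual φ)) = _
      rw [← InnerProductSpace.toDual_symm_apply, ← inner_conj_symm,
        InnerProductSpace.toDual_symm_apply]
      rfl
    simp only [hf]
    exact RCLike.continuous_conj.comp (WeakDual.eval_continuous _)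
  convert (WeakDual.isCompact_closedBall (𝕜 := 𝕜) (E := E) 0 r).image hΦ using 1
  ext v
  constructor
  · rintro ⟨x, hx, rfl⟩
    refine ⟨StrongDual.toWeakDual (InnerProductSpace.toDual 𝕜 E x), by simpa using hx, ?_⟩
    exact congrArg (toWeakSpace 𝕜 E) ((InnerProductSpace.toDual 𝕜 E).symm_apply_apply x)
  · rintro ⟨φ, hφ, rfl⟩
    exact ⟨_, by simpa using hφ, rfl⟩

theorem exists_isCompact_of_isBounded_range {x : ι → E} (hx : IsBounded (range x)) :
    ∃ K : Set (WeakSpace 𝕜 E), IsCompact K ∧ ∀ i, toWeakSpace 𝕜 E (x i) ∈ K := by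
  obtain ⟨r, hr⟩ := hx.subset_closedBall 0
  exact ⟨_, isCompact_toWeakSpace_image_closedBall r,
    fun i => mem_image_of_mem _ (hr (mem_range_self i))⟩

theorem exists_tendsto_toWeakSpace_of_isBounded_range (U : Ultrafilter ι) {x : ι → E}
    (hx : IsBounded (range x)) :
    ∃ l, Tendsto (fun i => toWeakSpace 𝕜 E (x i)) U (𝓝 (toWeakSpace 𝕜 E l)) := by
  obtain ⟨K, hK, hxK⟩ := exists_isCompact_of_isBounded_range (𝕜 := 𝕜) hx
  obtain ⟨l, -, hl⟩ := hK.ultrafilter_le_nhds (U.map fun i => toWeakSpace 𝕜 E (x i))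
    (tendsto_principal.2 (.of_forall hxK))
  exact ⟨l, hl⟩

end WeakTopology

variable {H ι : Type*} [NormedAddCommGroup H] [InnerProductSpace ℝ H]

section Opial

theorem eq_of_mapClusterPt_of_tendsto_norm_sub {F : Filter ι} {x : ι → H} {l m : H}
    {r s : ℝ} (hr : Tendsto (fun i => ‖x i - l‖) F (𝓝 r))
    (hs : Tendsto (fun i => ‖x i - m‖) F (𝓝 s))
    (hl : MapClusterPt (toWeakSpace ℝ H l) F fun i => toWeakSpace ℝ H (x i))
    (hm : MapClusterPt (toWeakSpace ℝ H m) F fun i => toWeakSpace ℝ H (x i)) : l = m := by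
  have hlim : Tendsto (fun i => ⟪m - l, x i⟫_ℝ) F
      (𝓝 ((r ^ 2 - s ^ 2 - ‖l‖ ^ 2 + ‖m‖ ^ 2) / 2)) := by
    refine (((((hr.pow 2).sub (hs.pow 2)).sub_const (‖l‖ ^ 2)).add_const
      (‖m‖ ^ 2)).div_const 2).congr fun i => ?_
    rw [norm_sub_sq_real, norm_sub_sq_real, inner_sub_left, real_inner_comm m,
      real_inner_comm l]
    ring
  obtain ⟨U, hU, hUl⟩ := mapClusterPt_iff_ultrafilter.1 hl
  obtain ⟨V, hV, hVm⟩ := mapClusterPt_iff_ultrafilter.1 hm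
  have hinner : ⟪m - l, l⟫_ℝ = ⟪m - l, m⟫_ℝ :=
    (tendsto_nhds_unique (tendsto_inner_of_tendsto_toWeakSpace hUl _) (hlim.mono_left hU)).trans
      (tendsto_nhds_unique (tendsto_inner_of_tendsto_toWeakSpace hVm _) (hlim.mono_left hV)).symm
  have hself : ⟪m - l, m - l⟫_ℝ = 0 := by rw [inner_sub_right, hinner, sub_self]
  exact (sub_eq_zero.1 (inner_self_eq_zero.1 hself)).symm

/-- Opial's lemma. -/
theorem exists_weaklyConvergesTo_of_tendsto_norm_sub [CompleteSpace H] {S : Set H} {x : ℕ → H}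
    (hS : S.Nonempty) (hx : ∀ z ∈ S, ∃ r, Tendsto (fun n => ‖x n - z‖) atTop (𝓝 r))
    (hcluster : ∀ l, MapClusterPt (toWeakSpace ℝ H l) atTop (fun n => toWeakSpace ℝ H (x n)) →
      l ∈ S) :
    ∃ l ∈ S, WeaklyConvergesTo x l := by
  obtain ⟨z, hz⟩ := hS
  obtain ⟨r, hr⟩ := hx z hz
  obtain ⟨K, hK, hxK⟩ := exists_isCompact_of_isBounded_range (𝕜 := ℝ)
    (isBounded_range_of_tendsto_norm_sub hr)
  obtain ⟨l, -, hl⟩ := hK.exists_mapClusterPt (f := atTop) (tendsto_principal.2 (.of_forall hxK))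
  obtain ⟨l, rfl⟩ := (toWeakSpace ℝ H).surjective l
  refine ⟨l, hcluster l hl, hK.tendsto_nhds_of_unique_mapClusterPt (.of_forall hxK) ?_⟩
  intro m _ hm
  obtain ⟨m, rfl⟩ := (toWeakSpace ℝ H).surjective m
  obtain ⟨r, hr⟩ := hx l (hcluster l hl)
  obtain ⟨s, hs⟩ := hx m (hcluster m hm)
  exact congrArg (toWeakSpace ℝ H) (eq_of_mapClusterPt_of_tendsto_norm_sub hs hr hm hl)

end Opial

section MonotoneOperators

variable {A B : H → Set H}

theorem isMaximallyMonotone_iff :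
    IsMaximallyMonotone A ↔ ∀ x u, u ∈ A x ↔ ∀ y v, v ∈ A y → 0 ≤ ⟪x - y, u - v⟫_ℝ := by
  constructor
  · refine fun ⟨hA, hmax⟩ x u => ⟨fun hu y v => hA x y u v hu, fun h => ?_⟩
    by_contra hu
    refine hmax ⟨fun y => A y ∪ {v | y = x ∧ v = u}, ?_, fun p hp => Or.inl hp,
      fun hsub => hu (hsub (a := (x, u)) (Or.inr ⟨rfl, rfl⟩))⟩
    rintro a b p q (hp | ⟨rfl, rfl⟩) (hq | ⟨rfl, rfl⟩)
    · exact hA _ _ _ _ hp hq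
    · rw [← inner_neg_neg, neg_sub, neg_sub]
      exact h _ _ hp
    · exact h _ _ hq
    · simp
  · refine fun h => ⟨fun x y u v hu => (h x u).1 hu y v, ?_⟩
    rintro ⟨S, hS, hAS, hSA⟩
    exact hSA fun ⟨x, u⟩ hu => (h x u).2 fun y v hv => hS x y u v hu (hAS (a := (y, v)) hv)

theorem eq_of_forall_inner_sub_nonneg {T : H → H} (hT : Continuous T) {x u : H}
    (h : ∀ y, 0 ≤ ⟪x - y, u - T y⟫_ℝ) : u = T x := by
  -- Minty's trick: test with `y = x - t • (T x - u)` and let `t → 0⁺`.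
  have hpos : ∀ t : ℝ, 0 < t → 0 ≤ ⟪T x - u, u - T (x - t • (T x - u))⟫_ℝ := fun t ht => by
    have := h (x - t • (T x - u))
    rw [sub_sub_cancel, real_inner_smul_left] at this
    exact nonneg_of_mul_nonneg_right this ht
  have hcont : Continuous fun t : ℝ => ⟪T x - u, u - T (x - t • (T x - u))⟫_ℝ := by fun_prop
  have hlim := (hcont.tendsto 0).mono_left (nhdsWithin_le_nhds (s := Ioi 0))
  have hle := ge_of_tendsto hlim (eventually_mem_nhdsWithin.mono hpos)
  rw [zero_smul, sub_zero, ← neg_sub (T x) u, inner_neg_right, neg_nonneg,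
    real_inner_self_nonpos, sub_eq_zero] at hle
  exact hle.symm

theorem isMaximallyMonotone_toSetOp {T : H → H} (hT : IsMonotoneOp (toSetOp T))
    (hTc : Continuous T) : IsMaximallyMonotone (toSetOp T) :=
  isMaximallyMonotone_iff.2 fun x u => ⟨fun hu y v => hT x y u v hu,
    fun h => eq_of_forall_inner_sub_nonneg hTc fun y => h y (T y) rfl⟩

section WeakLimits

variable {F : Filter ι} [F.NeBot] {a u : ι → H} {x v : H} {σ : ℝ}

theorem IsMonotoneOp.inner_sub_le_of_tendsto (hA : IsMonotoneOp A) (hu : ∀ i, u i ∈ A (a i))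
    (hax : Tendsto (fun i => toWeakSpace ℝ H (a i)) F (𝓝 (toWeakSpace ℝ H x)))
    (huv : Tendsto (fun i => toWeakSpace ℝ H (u i)) F (𝓝 (toWeakSpace ℝ H v)))
    (hσ : Tendsto (fun i => ⟪a i, u i⟫_ℝ) F (𝓝 σ)) {p w : H} (hw : w ∈ A p) :
    ⟪x, v⟫_ℝ - σ ≤ ⟪x - p, v - w⟫_ℝ := by
  have hexpand : ∀ b q : H, ⟪b - p, q - w⟫_ℝ = ⟪b, q⟫_ℝ - ⟪w, b⟫_ℝ - ⟪p, q⟫_ℝ + ⟪p, w⟫_ℝ :=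
    fun b q => by
      rw [inner_sub_left, inner_sub_right, inner_sub_right, real_inner_comm w b]
      ring
  have hlim : Tendsto (fun i => ⟪a i - p, u i - w⟫_ℝ) F
      (𝓝 (σ - ⟪w, x⟫_ℝ - ⟪p, v⟫_ℝ + ⟪p, w⟫_ℝ)) := by
    simp only [hexpand]
    exact ((hσ.sub (tendsto_inner_of_tendsto_toWeakSpace hax w)).sub
      (tendsto_inner_of_tendsto_toWeakSpace huv p)).add_const _
  have hnonneg := ge_of_tendsto' hlim fun i => hA _ _ _ _ (hu i) hw
  rw [hexpand]
  linarith

theorem IsMaximallyMonotone.mem_of_tendsto (hA : IsMaximallyMonotone A)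
    (hu : ∀ i, u i ∈ A (a i))
    (hax : Tendsto (fun i => toWeakSpace ℝ H (a i)) F (𝓝 (toWeakSpace ℝ H x)))
    (huv : Tendsto (fun i => toWeakSpace ℝ H (u i)) F (𝓝 (toWeakSpace ℝ H v)))
    (hσ : Tendsto (fun i => ⟪a i, u i⟫_ℝ) F (𝓝 σ)) (hσ_le : σ ≤ ⟪x, v⟫_ℝ) : v ∈ A x :=
  (isMaximallyMonotone_iff.1 hA x v).2 fun _ _ hw =>
    (sub_nonneg.2 hσ_le).trans (hA.1.inner_sub_le_of_tendsto hu hax huv hσ hw)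

theorem IsMaximallyMonotone.inner_le_of_tendsto (hA : IsMaximallyMonotone A)
    (hu : ∀ i, u i ∈ A (a i))
    (hax : Tendsto (fun i => toWeakSpace ℝ H (a i)) F (𝓝 (toWeakSpace ℝ H x)))
    (huv : Tendsto (fun i => toWeakSpace ℝ H (u i)) F (𝓝 (toWeakSpace ℝ H v)))
    (hσ : Tendsto (fun i => ⟪a i, u i⟫_ℝ) F (𝓝 σ)) : ⟪x, v⟫_ℝ ≤ σ := by
  by_contra! hlt
  have hv : v ∈ A x := hA.mem_of_tendsto hu hax huv hσ hlt.le
  have hle := hA.1.inner_sub_le_of_tendsto hu hax huv hσ hv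
  rw [sub_self, inner_zero_left] at hle
  linarith

end WeakLimits

theorem mem_zer_add_of_tendsto [CompleteSpace H] (hA : IsMaximallyMonotone A)
    (hB : IsMaximallyMonotone B) {F : Filter ι} [F.NeBot] {a b u v : ι → H} {l : H}
    (hu : ∀ i, u i ∈ A (a i)) (hv : ∀ i, v i ∈ B (b i))
    (ha_bdd : IsBounded (range a)) (hv_bdd : IsBounded (range v))
    (hab : Tendsto (fun i => a i - b i) F (𝓝 0)) (huv : Tendsto (fun i => u i + v i) F (𝓝 0))
    (hal : Tendsto (fun i => toWeakSpace ℝ H (a i)) F (𝓝 (toWeakSpace ℝ H l))) :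
    l ∈ zer (A + B) := by
  let U := Ultrafilter.of F
  have hUF : ↑U ≤ F := Ultrafilter.of_le F
  replace hab := hab.mono_left hUF
  replace huv := huv.mono_left hUF
  replace hal := hal.mono_left hUF
  obtain ⟨q, hvq⟩ := exists_tendsto_toWeakSpace_of_isBounded_range (𝕜 := ℝ) U hv_bdd
  obtain ⟨σ, hσ⟩ := exists_tendsto_inner_of_isBounded_range (𝕜 := ℝ) U ha_bdd hv_bdd
  have hbl : Tendsto (fun i => toWeakSpace ℝ H (b i)) U (𝓝 (toWeakSpace ℝ H l)) := by
    simpa using hal.sub (tendsto_toWeakSpace_of_tendsto (𝕜 := ℝ) hab)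
  have huq : Tendsto (fun i => toWeakSpace ℝ H (u i)) U (𝓝 (toWeakSpace ℝ H (-q))) := by
    simpa using (tendsto_toWeakSpace_of_tendsto (𝕜 := ℝ) huv).sub hvq
  have hbv : Tendsto (fun i => ⟪b i, v i⟫_ℝ) U (𝓝 σ) := by
    simpa [inner_sub_right, real_inner_comm] using
      hσ.sub (tendsto_inner_zero_of_isBounded_range (𝕜 := ℝ) hv_bdd hab)
  have hau : Tendsto (fun i => ⟪a i, u i⟫_ℝ) U (𝓝 (-σ)) := by
    simpa [inner_add_right] using
      (tendsto_inner_zero_of_isBounded_range (𝕜 := ℝ) ha_bdd huv).sub hσ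
  -- Each operator bounds its limiting pairing from below; as the pairings cancel, both are tight.
  have hσ_ge : ⟪l, q⟫_ℝ ≤ σ := hB.inner_le_of_tendsto hv hbl hvq hbv
  have hσ_le : ⟪l, -q⟫_ℝ ≤ -σ := hA.inner_le_of_tendsto hu hal huq hau
  rw [inner_neg_right, neg_le_neg_iff] at hσ_le
  have hqA : -q ∈ A l := hA.mem_of_tendsto hu hal huq hau (by rwa [inner_neg_right, neg_le_neg_iff])
  have hqB : q ∈ B l := hB.mem_of_tendsto hv hbl hvq hbv hσ_le
  exact Set.mem_add.2 ⟨-q, hqA, q, hqB, neg_add_cancel q⟩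

end MonotoneOperators

section CocoerciveOperators

variable {B : H → H} {β : ℝ}

theorem IsCocoercive.isMonotoneOp (hB : IsCocoercive β B) (hβ : 0 ≤ β) :
    IsMonotoneOp (toSetOp B) := by
  rintro x y _ _ rfl rfl
  exact (mul_nonneg hβ (sq_nonneg _)).trans (hB x y)

theorem IsCocoercive.lipschitzWith (hB : IsCocoercive β B) (hβ : 0 < β) :
    LipschitzWith (Real.toNNReal β⁻¹) B := by
  refine lipschitzWith_iff_norm_sub_le.2 fun x y => ?_
  rw [Real.coe_toNNReal _ (inv_pos.2 hβ).le, le_inv_mul_iff₀ hβ]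
  rcases (norm_nonneg (B x - B y)).eq_or_lt with h0 | hpos
  · simp [← h0]
  · refine le_of_mul_le_mul_right ?_ hpos
    calc β * ‖B x - B y‖ * ‖B x - B y‖ = β * ‖B x - B y‖ ^ 2 := by ring
      _ ≤ ⟪x - y, B x - B y⟫_ℝ := hB x y
      _ ≤ ‖x - y‖ * ‖B x - B y‖ := real_inner_le_norm _ _

end CocoerciveOperators

theorem neg_le_two_mul_inner (γ : ℝ) (u v : H) :
    -(γ ^ 2 * ‖u‖ ^ 2 + ‖v‖ ^ 2) ≤ 2 * γ * ⟪u, v⟫_ℝ := by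
  have h := norm_add_sq_real (γ • u) v
  rw [norm_smul, mul_pow, Real.norm_eq_abs, sq_abs, real_inner_smul_left] at h
  linarith [sq_nonneg ‖γ • u + v‖]

theorem neg_le_mul_inner_of_lipschitzWith {B : H → H} {μ : ℝ≥0} (hB : LipschitzWith μ B)
    {γ : ℝ} (hγ : 0 ≤ γ) (p q v : H) :
    -(γ * μ * (‖p - q‖ * ‖v‖)) ≤ γ * ⟪B p - B q, v⟫_ℝ := by
  have hinner : -(‖B p - B q‖ * ‖v‖) ≤ ⟪B p - B q, v⟫_ℝ :=
    (abs_le.1 (abs_real_inner_le_norm _ _)).1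
  have hlip : ‖B p - B q‖ * ‖v‖ ≤ μ * ‖p - q‖ * ‖v‖ :=
    mul_le_mul_of_nonneg_right (hB.norm_sub_le p q) (norm_nonneg v)
  linarith [mul_le_mul_of_nonneg_left hinner hγ, mul_le_mul_of_nonneg_left hlip hγ]

namespace IsReflectedForwardBackward

variable {A : H → Set H} {B : H → H} {γ : ℝ} {xneg : H} {x y : ℕ → H}

theorem inv_smul_sub_mem (hx : IsReflectedForwardBackward A B γ xneg x y) (hγ : γ ≠ 0) (n : ℕ) :
    γ⁻¹ • (x n - x (n + 1)) - B (y n) ∈ A (x (n + 1)) := by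
  obtain ⟨_, rfl, _, ⟨a, ha, rfl⟩, h⟩ := hx.x_succ n
  have hstep : γ • a = x n - x (n + 1) - γ • B (y n) := by
    rw [sub_right_comm]
    exact eq_sub_of_add_eq' h
  rwa [← inv_smul_smul₀ hγ (B (y n)), ← smul_sub, ← hstep, inv_smul_smul₀ hγ]

theorem sub_y_succ (hx : IsReflectedForwardBackward A B γ xneg x y) (n : ℕ) :
    x (n + 2) - y (n + 1) = x (n + 2) - x (n + 1) - (x (n + 1) - x n) := by
  rw [hx.y_succ]
  module

theorem isBounded_range_y (hx : IsReflectedForwardBackward A B γ xneg x y)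
    (hbdd : IsBounded (range x)) : IsBounded (range y) := by
  obtain ⟨C, hC⟩ := isBounded_iff_forall_norm_le.1 hbdd
  have hxC : ∀ n, ‖x n‖ ≤ C := fun n => hC _ (mem_range_self n)
  have hreflect : ∀ u v : H, ‖(2 : ℝ) • u - v‖ ≤ 2 * ‖u‖ + ‖v‖ := fun u v => by
    simpa [norm_smul] using norm_sub_le ((2 : ℝ) • u) v
  refine isBounded_iff_forall_norm_le.2 ⟨2 * C + max C ‖xneg‖, forall_mem_range.2 fun n => ?_⟩
  cases n with
  | zero =>
    rw [hx.y_zero]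
    linarith [hreflect (x 0) xneg, hxC 0, le_max_right C ‖xneg‖]
  | succ n =>
    rw [hx.y_succ]
    linarith [hreflect (x (n + 1)) (x n), hxC n, hxC (n + 1), le_max_left C ‖xneg‖]

theorem norm_sub_sq_add_le (hx : IsReflectedForwardBackward A B γ xneg x y) (hγ : 0 < γ)
    (hA : IsMonotoneOp A) {z : H} (hz : z ∈ zer (A + toSetOp B)) (n : ℕ) :
    ‖x (n + 1) - z‖ ^ 2 + ‖x (n + 1) - x n‖ ^ 2 +
      2 * γ * ⟪B (y n) - B z, x (n + 1) - z⟫_ℝ ≤ ‖x n - z‖ ^ 2 := by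
  obtain ⟨a, ha, _, rfl, hab⟩ := Set.mem_add.1 hz
  have hmono := hA _ _ _ _ (hx.inv_smul_sub_mem hγ.ne' n) ha
  have hsplit : γ • (γ⁻¹ • (x n - x (n + 1)) - B (y n) - a) =
      x n - x (n + 1) - γ • (B (y n) - B z) := by
    rw [eq_neg_of_add_eq_zero_left hab, sub_neg_eq_add, sub_add, smul_sub, smul_inv_smul₀ hγ.ne']
  have hscaled := mul_nonneg hγ.le hmono
  rw [← real_inner_smul_right, hsplit, inner_sub_right, real_inner_smul_right,
    real_inner_comm] at hscaled
  have hpolar := norm_add_sq_real (x n - x (n + 1)) (x (n + 1) - z)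
  rw [sub_add_sub_cancel, norm_sub_rev (x n) (x (n + 1))] at hpolar
  rw [real_inner_comm (x (n + 1) - z)]
  linarith

theorem norm_sub_succ_sq_add_le (hx : IsReflectedForwardBackward A B γ xneg x y) (hγ : 0 < γ)
    (hA : IsMonotoneOp A) (n : ℕ) :
    ‖x (n + 2) - x (n + 1)‖ ^ 2 + ‖x (n + 2) - y (n + 1)‖ ^ 2 +
      2 * γ * ⟪B (y (n + 1)) - B (y n), x (n + 2) - x (n + 1)⟫_ℝ ≤ ‖x (n + 1) - x n‖ ^ 2 := by
  have hmono := hA _ _ _ _ (hx.inv_smul_sub_mem hγ.ne' (n + 1)) (hx.inv_smul_sub_mem hγ.ne' n)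
  have hsplit : γ • (γ⁻¹ • (x (n + 1) - x (n + 2)) - B (y (n + 1)) -
      (γ⁻¹ • (x n - x (n + 1)) - B (y n))) =
      -(x (n + 2) - y (n + 1)) - γ • (B (y (n + 1)) - B (y n)) := by
    rw [hx.sub_y_succ, sub_sub_sub_comm, ← smul_sub, smul_sub, smul_inv_smul₀ hγ.ne']
    abel
  have hscaled := mul_nonneg hγ.le hmono
  rw [← real_inner_smul_right, hsplit, inner_sub_right, inner_neg_right, real_inner_smul_right,
    real_inner_comm (B _ - B _)] at hscaled
  have hpolar := norm_sub_sq_real (x (n + 2) - x (n + 1)) (x (n + 2) - y (n + 1))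
  rw [hx.sub_y_succ, sub_sub_cancel, ← hx.sub_y_succ] at hpolar
  linarith

/-- The part common to the two Lyapunov functions of the iteration, relative to the point `z`. -/
def energy (B : H → H) (γ : ℝ) (x y : ℕ → H) (z : H) (n : ℕ) : ℝ :=
  ‖x (n + 1) - z‖ ^ 2 + 2 * γ * ⟪B (y n) - B z, x (n + 1) - x n⟫_ℝ + ‖x (n + 1) - x n‖ ^ 2

theorem energy_succ_add_le (hx : IsReflectedForwardBackward A B γ xneg x y) (hγ : 0 < γ)
    (hA : IsMonotoneOp A) {z : H} (hz : z ∈ zer (A + toSetOp B)) (n : ℕ) :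
    energy B γ x y z (n + 1) + ‖x (n + 2) - x (n + 1)‖ ^ 2 + ‖x (n + 2) - y (n + 1)‖ ^ 2 +
        2 * γ * ⟪B (y (n + 1)) - B z, y (n + 1) - z⟫_ℝ +
        2 * γ * ⟪B (y (n + 1)) - B (y n), x (n + 2) - y (n + 1)⟫_ℝ ≤
      energy B γ x y z n := by
  have hzero := hx.norm_sub_sq_add_le hγ hA hz (n + 1)
  have hsucc := hx.norm_sub_succ_sq_add_le hγ hA n
  have hinner : ⟪B (y (n + 1)) - B z, x (n + 2) - z⟫_ℝ +
        ⟪B (y (n + 1)) - B (y n), x (n + 2) - x (n + 1)⟫_ℝ =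
      ⟪B (y (n + 1)) - B z, x (n + 2) - x (n + 1)⟫_ℝ +
        ⟪B (y (n + 1)) - B z, y (n + 1) - z⟫_ℝ +
        ⟪B (y (n + 1)) - B (y n), x (n + 2) - y (n + 1)⟫_ℝ -
        ⟪B (y n) - B z, x (n + 1) - x n⟫_ℝ := by
    rw [hx.y_succ, two_smul]
    simp only [inner_sub_left, inner_sub_right, inner_add_right]
    ring
  simp only [energy]
  linarith [congrArg (2 * γ * ·) hinner]

theorem tendsto_sub_and_tendsto_norm_sub_of_energy_le
    (hx : IsReflectedForwardBackward A B γ xneg x y) {μ : ℝ≥0} (hB : LipschitzWith μ B)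
    {z : H} {c : ℝ} (hc : 0 < c) {R : ℕ → ℝ} (hR : ∀ n, 0 ≤ R n)
    (hlow : ∀ n, c * ‖x (n + 1) - z‖ ^ 2 ≤ energy B γ x y z n + R n)
    (hdec : ∀ n, energy B γ x y z (n + 1) + R (n + 1) +
      c * (‖x (n + 2) - x (n + 1)‖ ^ 2 + R (n + 1)) ≤ energy B γ x y z n + R n) :
    Tendsto (fun n => x (n + 1) - x n) atTop (𝓝 0) ∧
      ∃ r, Tendsto (fun n => ‖x n - z‖) atTop (𝓝 r) := by
  obtain ⟨⟨r, hr⟩, hD⟩ := exists_tendsto_and_tendsto_zero_of_add_le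
    (V := fun n => energy B γ x y z n + R n)
    (fun n => (mul_nonneg hc.le (sq_nonneg _)).trans (hlow n))
    (fun n => mul_nonneg hc.le (add_nonneg (sq_nonneg _) (hR _))) hdec
  replace hD : Tendsto (fun n => ‖x (n + 2) - x (n + 1)‖ ^ 2 + R (n + 1)) atTop (𝓝 0) := by
    simpa [hc.ne'] using hD.const_mul c⁻¹
  have hR0 : Tendsto R atTop (𝓝 0) := (tendsto_add_atTop_iff_nat 1).1
    (squeeze_zero (fun n => hR _) (fun n => le_add_of_nonneg_left (sq_nonneg _)) hD)
  have hd0 : Tendsto (fun n => x (n + 1) - x n) atTop (𝓝 0) :=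
    (tendsto_add_atTop_iff_nat 1).1 (tendsto_zero_of_tendsto_norm_sq
      (squeeze_zero (fun n => sq_nonneg _) (fun n => le_add_of_nonneg_right (hR _)) hD))
  have hxbdd : IsBounded (range x) := by
    obtain ⟨M, hM⟩ := hr.bddAbove_range
    refine isBounded_iff_forall_norm_le.2 ⟨max ‖x 0‖ (√(M / c) + ‖z‖), forall_mem_range.2 ?_⟩
    rintro (_ | n)
    · exact le_max_left _ _
    · refine le_max_of_le_right ((norm_le_norm_sub_add _ z).trans (add_le_add_left ?_ _))
      refine Real.le_sqrt_of_sq_le ((le_div_iff₀' hc).2 ?_)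
      exact (hlow n).trans (hM (mem_range_self n))
  have hBy : IsBounded (range fun n => B (y n) - B z) := by
    rw [range_comp' (fun v => B v - B z) y]
    exact (hB.sub (LipschitzWith.const (B z))).isBounded_image (hx.isBounded_range_y hxbdd)
  have hcross : Tendsto (fun n => ⟪B (y n) - B z, x (n + 1) - x n⟫_ℝ) atTop (𝓝 0) :=
    tendsto_inner_zero_of_isBounded_range hBy hd0
  have hsq : Tendsto (fun n => ‖x (n + 1) - z‖ ^ 2) atTop (𝓝 r) := by
    have hsub := ((hr.sub hR0).sub (hcross.const_mul (2 * γ))).sub (hd0.norm.pow 2)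
    rw [norm_zero, mul_zero, zero_pow two_ne_zero, sub_zero, sub_zero, sub_zero] at hsub
    refine hsub.congr fun n => ?_
    rw [energy]
    ring
  refine ⟨hd0, √r, (tendsto_add_atTop_iff_nat 1).1 ?_⟩
  simpa using hsq.sqrt

theorem tendsto_sub_and_tendsto_norm_sub_of_isCocoercive
    (hx : IsReflectedForwardBackward A B γ xneg x y) {β : ℝ} (hγ : 0 < γ) (hγβ : 2 * γ < β)
    (hA : IsMonotoneOp A) (hB : IsCocoercive β B) {z : H} (hz : z ∈ zer (A + toSetOp B)) :
    Tendsto (fun n => x (n + 1) - x n) atTop (𝓝 0) ∧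
      ∃ r, Tendsto (fun n => ‖x n - z‖) atTop (𝓝 r) := by
  have hc : 0 < min 1 (β / γ - 2) :=
    lt_min one_pos (sub_pos.2 ((lt_div_iff₀ hγ).2 hγβ))
  have hcβ : min 1 (β / γ - 2) * γ ≤ β - 2 * γ := by
    calc min 1 (β / γ - 2) * γ ≤ (β / γ - 2) * γ := by gcongr; exact min_le_right _ _
      _ = β - 2 * γ := by rw [sub_mul, div_mul_cancel₀ _ hγ.ne']
  refine hx.tendsto_sub_and_tendsto_norm_sub_of_energy_le (hB.lipschitzWith (by linarith)) hc
    (R := fun n => 2 * γ ^ 2 * ‖B (y n) - B z‖ ^ 2) (fun n => by positivity)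
    (fun n => ?_) (fun n => ?_)
  · have hyoung := neg_le_two_mul_inner γ (B (y n) - B z) (x (n + 1) - x n)
    have hle_one := mul_le_of_le_one_left (sq_nonneg ‖x (n + 1) - z‖) (min_le_left 1 (β / γ - 2))
    simp only [energy]
    linarith [mul_nonneg (sq_nonneg γ) (sq_nonneg ‖B (y n) - B z‖)]
  · have hyoung := neg_le_two_mul_inner γ (B (y (n + 1)) - B (y n)) (x (n + 2) - y (n + 1))
    have hpar := parallelogram_law_with_norm ℝ (B (y (n + 1)) - B z) (B (y n) - B z)
    rw [sub_sub_sub_cancel_right] at hpar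
    have hpar_le : ‖B (y (n + 1)) - B (y n)‖ ^ 2 ≤
        2 * (‖B (y (n + 1)) - B z‖ ^ 2 + ‖B (y n) - B z‖ ^ 2) := by
      linarith [mul_self_nonneg ‖B (y (n + 1)) - B z + (B (y n) - B z)‖]
    have hcoc := hB (y (n + 1)) z
    rw [real_inner_comm] at hcoc
    have hmargin := mul_le_mul_of_nonneg_right hcβ
      (mul_nonneg hγ.le (sq_nonneg ‖B (y (n + 1)) - B z‖))
    linarith [hx.energy_succ_add_le hγ hA hz n, mul_le_mul_of_nonneg_left hcoc hγ.le,
      mul_le_mul_of_nonneg_left hpar_le (sq_nonneg γ),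
      mul_le_of_le_one_left (sq_nonneg ‖x (n + 2) - x (n + 1)‖) (min_le_left 1 (β / γ - 2))]

theorem sub_le_energy_of_lipschitzWith {μ : ℝ≥0} (hγ : 0 ≤ γ) (hB : LipschitzWith μ B) (z : H)
    (n : ℕ) :
    (1 - γ * μ) * ‖x (n + 1) - z‖ ^ 2 + (1 - 2 * (γ * μ)) * ‖x (n + 1) - x n‖ ^ 2 -
      γ * μ * ‖x (n + 1) - y n‖ ^ 2 ≤ energy B γ x y z n := by
  have hinner := neg_le_mul_inner_of_lipschitzWith hB hγ (y n) z (x (n + 1) - x n)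
  have htri : ‖y n - z‖ ≤ ‖x (n + 1) - z‖ + ‖x (n + 1) - y n‖ := by
    rw [add_comm, norm_sub_rev _ (y n)]
    exact norm_sub_le_norm_sub_add_norm_sub _ _ _
  have hyoung : 2 * (‖y n - z‖ * ‖x (n + 1) - x n‖) ≤
      ‖x (n + 1) - z‖ ^ 2 + ‖x (n + 1) - y n‖ ^ 2 + 2 * ‖x (n + 1) - x n‖ ^ 2 := by
    linarith [mul_le_mul_of_nonneg_right htri (norm_nonneg (x (n + 1) - x n)),
      two_mul_le_add_sq ‖x (n + 1) - z‖ ‖x (n + 1) - x n‖,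
      two_mul_le_add_sq ‖x (n + 1) - y n‖ ‖x (n + 1) - x n‖]
  rw [energy]
  linarith [mul_le_mul_of_nonneg_left hyoung (mul_nonneg hγ μ.coe_nonneg)]

theorem energy_succ_add_le_of_lipschitzWith (hx : IsReflectedForwardBackward A B γ xneg x y)
    {μ : ℝ≥0} (hγ : 0 < γ) (hA : IsMonotoneOp A) (hB : IsMonotoneOp (toSetOp B))
    (hBL : LipschitzWith μ B) {z : H} (hz : z ∈ zer (A + toSetOp B)) (n : ℕ) :
    energy B γ x y z (n + 1) + ‖x (n + 2) - x (n + 1)‖ ^ 2 +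
        (1 - γ * μ * √2) * ‖x (n + 2) - y (n + 1)‖ ^ 2 ≤
      energy B γ x y z n + γ * μ * (1 + √2) * ‖x (n + 1) - x n‖ ^ 2 +
        γ * μ * ‖x (n + 1) - y n‖ ^ 2 := by
  have hmono : 0 ≤ ⟪B (y (n + 1)) - B z, y (n + 1) - z⟫_ℝ := by
    rw [real_inner_comm]
    exact hB _ _ _ _ rfl rfl
  have hinner := neg_le_mul_inner_of_lipschitzWith hBL hγ.le (y (n + 1)) (y n)
    (x (n + 2) - y (n + 1))
  have htri : ‖y (n + 1) - y n‖ ≤ ‖x (n + 1) - x n‖ + ‖x (n + 1) - y n‖ := by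
    refine (congrArg norm ?_).trans_le (norm_add_le _ _)
    rw [hx.y_succ]
    module
  -- A Young weight `w` leaves the factors `1 - γ * μ * w` and `1 - γ * μ * (2 + w⁻¹)` once the
  -- error terms telescope; they vanish at the same step size when `w = 2 + w⁻¹`, i.e. `w = 1 + √2`.
  have hyoung : 2 * (‖y (n + 1) - y n‖ * ‖x (n + 2) - y (n + 1)‖) ≤
      (1 + √2) * ‖x (n + 1) - x n‖ ^ 2 + ‖x (n + 1) - y n‖ ^ 2 +
        √2 * ‖x (n + 2) - y (n + 1)‖ ^ 2 := by
    have hinv : (1 + √2)⁻¹ = √2 - 1 :=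
      inv_eq_of_mul_eq_one_right (by linarith [Real.mul_self_sqrt zero_le_two])
    have hweighted := two_mul_le_add_mul_sq (a := ‖x (n + 1) - x n‖)
      (b := ‖x (n + 2) - y (n + 1)‖) (ε := 1 + √2) (by positivity)
    rw [hinv] at hweighted
    linarith [mul_le_mul_of_nonneg_right htri (norm_nonneg (x (n + 2) - y (n + 1))),
      two_mul_le_add_sq ‖x (n + 1) - y n‖ ‖x (n + 2) - y (n + 1)‖]
  linarith [hx.energy_succ_add_le hγ hA hz n, mul_nonneg hγ.le hmono,
    mul_le_mul_of_nonneg_left hyoung (mul_nonneg hγ.le μ.coe_nonneg)]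

theorem tendsto_sub_and_tendsto_norm_sub_of_lipschitzWith
    (hx : IsReflectedForwardBackward A B γ xneg x y) {μ : ℝ≥0} (hγ : 0 < γ) (hγμ : γ * μ < √2 - 1)
    (hA : IsMonotoneOp A) (hB : IsMonotoneOp (toSetOp B)) (hBL : LipschitzWith μ B) {z : H}
    (hz : z ∈ zer (A + toSetOp B)) :
    Tendsto (fun n => x (n + 1) - x n) atTop (𝓝 0) ∧
      ∃ r, Tendsto (fun n => ‖x n - z‖) atTop (𝓝 r) := by
  have hκ : 0 ≤ γ * μ := mul_nonneg hγ.le μ.coe_nonneg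
  have hκτ : γ * μ * (1 + √2) < 1 := by
    calc γ * μ * (1 + √2) < (√2 - 1) * (1 + √2) := by gcongr
      _ = 1 := by linarith [Real.mul_self_sqrt zero_le_two]
  have hκ_le : γ * μ ≤ γ * μ * √2 :=
    le_mul_of_one_le_right hκ (Real.one_le_sqrt.2 one_le_two)
  refine hx.tendsto_sub_and_tendsto_norm_sub_of_energy_le hBL
    (c := (1 - γ * μ * (1 + √2)) / 2) (by linarith)
    (R := fun n => γ * μ * (1 + √2) * ‖x (n + 1) - x n‖ ^ 2 + γ * μ * ‖x (n + 1) - y n‖ ^ 2)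
    (fun n => by positivity) (fun n => ?_) (fun n => ?_)
  · have hlow := sub_le_energy_of_lipschitzWith (x := x) (y := y) hγ.le hBL z n
    nlinarith [sq_nonneg ‖x (n + 1) - z‖, sq_nonneg ‖x (n + 1) - x n‖]
  · have hdec := hx.energy_succ_add_le_of_lipschitzWith hγ hA hB hBL hz n
    have hR_le : γ * μ * (1 + √2) * ‖x (n + 2) - x (n + 1)‖ ^ 2 +
        γ * μ * ‖x (n + 2) - y (n + 1)‖ ^ 2 ≤
        ‖x (n + 2) - x (n + 1)‖ ^ 2 + ‖x (n + 2) - y (n + 1)‖ ^ 2 :=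
      add_le_add (mul_le_of_le_one_left (sq_nonneg _) hκτ.le)
        (mul_le_of_le_one_left (sq_nonneg _) (by linarith))
    have hmargin := mul_le_mul_of_nonneg_left hR_le (sub_nonneg.2 hκτ.le)
    have hmargin_e := mul_nonneg (sub_nonneg.2 hκτ.le) (sq_nonneg ‖x (n + 2) - y (n + 1)‖)
    simp only [add_assoc, Nat.reduceAdd] at hdec hmargin ⊢
    linarith

theorem exists_weaklyConvergesTo [CompleteSpace H]
    (hx : IsReflectedForwardBackward A B γ xneg x y) {μ : ℝ≥0} (hγ : γ ≠ 0)
    (hA : IsMaximallyMonotone A) (hB : IsMonotoneOp (toSetOp B)) (hBL : LipschitzWith μ B)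
    (hzer : (zer (A + toSetOp B)).Nonempty)
    (hlim : ∀ z ∈ zer (A + toSetOp B), Tendsto (fun n => x (n + 1) - x n) atTop (𝓝 0) ∧
      ∃ r, Tendsto (fun n => ‖x n - z‖) atTop (𝓝 r)) :
    ∃ l ∈ zer (A + toSetOp B), WeaklyConvergesTo x l := by
  obtain ⟨z, hz⟩ := hzer
  obtain ⟨hd, r, hr⟩ := hlim z hz
  have hx_bdd := isBounded_range_of_tendsto_norm_sub hr
  have hd_succ := hd.comp (tendsto_add_atTop_nat 1)
  have hBy_bdd : IsBounded (range fun n => B (y (n + 1))) := by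
    refine (hBL.isBounded_image (hx.isBounded_range_y hx_bdd)).subset ?_
    exact range_subset_iff.2 fun n => mem_image_of_mem B (mem_range_self (n + 1))
  have hxy : Tendsto (fun n => x (n + 2) - y (n + 1)) atTop (𝓝 0) := by
    simpa [hx.sub_y_succ, Function.comp_def] using hd_succ.sub hd
  have hsum : Tendsto
      (fun n => γ⁻¹ • (x (n + 1) - x (n + 2)) - B (y (n + 1)) + B (y (n + 1))) atTop (𝓝 0) := by
    simpa [Function.comp_def, ← smul_neg] using (hd_succ.const_smul γ⁻¹).neg
  refine exists_weaklyConvergesTo_of_tendsto_norm_sub ⟨z, hz⟩ (fun z hz => (hlim z hz).2) ?_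
  intro l hl
  obtain ⟨U, hU, hUl⟩ := mapClusterPt_iff_ultrafilter.1 hl
  have hx_succ : Tendsto (fun n => toWeakSpace ℝ H (x (n + 2))) U (𝓝 (toWeakSpace ℝ H l)) := by
    simpa using (tendsto_toWeakSpace_of_tendsto (𝕜 := ℝ) ((hd_succ.add hd).mono_left hU)).add hUl
  exact mem_zer_add_of_tendsto hA (isMaximallyMonotone_toSetOp hB hBL.continuous)
    (fun n => hx.inv_smul_sub_mem hγ (n + 1)) (fun n => rfl)
    (hx_bdd.subset (range_comp_subset_range (· + 2) x)) hBy_bdd (hxy.mono_left hU)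
    (hsum.mono_left hU) hx_succ

theorem exists_weaklyConvergesTo_of_isCocoercive [CompleteSpace H]
    (hx : IsReflectedForwardBackward A B γ xneg x y) {β : ℝ} (hγ : 0 < γ) (hγβ : 2 * γ < β)
    (hA : IsMaximallyMonotone A) (hB : IsCocoercive β B)
    (hzer : (zer (A + toSetOp B)).Nonempty) :
    ∃ l ∈ zer (A + toSetOp B), WeaklyConvergesTo x l := by
  have hβ : 0 < β := by linarith
  exact hx.exists_weaklyConvergesTo hγ.ne' hA (hB.isMonotoneOp hβ.le) (hB.lipschitzWith hβ) hzer
    fun _ hz => hx.tendsto_sub_and_tendsto_norm_sub_of_isCocoercive hγ hγβ hA.1 hB hz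

theorem exists_weaklyConvergesTo_of_lipschitzWith [CompleteSpace H]
    (hx : IsReflectedForwardBackward A B γ xneg x y) {μ : ℝ≥0} (hγ : 0 < γ)
    (hγμ : γ * μ < √2 - 1) (hA : IsMaximallyMonotone A) (hB : IsMonotoneOp (toSetOp B))
    (hBL : LipschitzWith μ B) (hzer : (zer (A + toSetOp B)).Nonempty) :
    ∃ l ∈ zer (A + toSetOp B), WeaklyConvergesTo x l :=
  hx.exists_weaklyConvergesTo hγ.ne' hA hB hBL hzer
    fun _ hz => hx.tendsto_sub_and_tendsto_norm_sub_of_lipschitzWith hγ hγμ hA.1 hB hBL hz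

end IsReflectedForwardBackward

end MonotoneInclusion

theorem theorem1 {H : Type*} [NormedAddCommGroup H] [InnerProductSpace ℝ H] [CompleteSpace H]
    (A : H → Set H) (B : H → H) (μ : ℝ≥0) (hμ : 0 < μ)
    (hA : MonotoneInclusion.IsMaximallyMonotone A)
    (hB : MonotoneInclusion.IsMonotoneOp (MonotoneInclusion.toSetOp B))
    (hBL : LipschitzWith μ B)
    (hzer : (MonotoneInclusion.zer (A + MonotoneInclusion.toSetOp B)).Nonempty)
    (γ : ℝ) (xneg : H) (x y : ℕ → H)
    (hx : MonotoneInclusion.IsReflectedForwardBackward A B γ xneg x y) :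
    (∀ β : ℝ, 0 < β → ∀ ε ∈ Ioo (0 : ℝ) 1, MonotoneInclusion.IsCocoercive β B →
      γ ∈ Ioc (0 : ℝ) (β * (1 - ε) / 2) →
      ∃ xbar ∈ MonotoneInclusion.zer (A + MonotoneInclusion.toSetOp B),
        MonotoneInclusion.WeaklyConvergesTo x xbar) ∧
    (γ ∈ Ioo (0 : ℝ) ((√2 - 1) / μ) →
      ∃ xbar ∈ MonotoneInclusion.zer (A + MonotoneInclusion.toSetOp B),
        MonotoneInclusion.WeaklyConvergesTo x xbar) := by
  refine ⟨fun β hβ ε hε hcoc hγ => ?_, fun hγ => ?_⟩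
  · have hγβ : 2 * γ < β := by linarith [hγ.2, mul_pos hβ hε.1]
    exact hx.exists_weaklyConvergesTo_of_isCocoercive hγ.1 hγβ hA hcoc hzer
  · have hγμ : γ * μ < √2 - 1 := (lt_div_iff₀ (NNReal.coe_pos.2 hμ)).1 hγ.2
    exact hx.exists_weaklyConvergesTo_of_lipschitzWith hγ.1 hγμ hA hB hBL hzer
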